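/- Let $n_1,n_2\ge 1$, $m_1\ge 0$ and $m_2\ge n_2+1$ be integers, and consider the two-stage stochastic linear program $\min_{x\in X}\mathbb E\,F(x,\boldsymbol\xi)$, where $X=\{x\in\mathbb R^{n_1}:Ax\le b\}$ is given by $m_1$ inequalities, $\boldsymbol\xi$ is a random vector in $\mathbb R^d$, $F(x,\xi)=c^{T}x+Q(x,\xi)$ and $$Q(x,\xi)=\min_{y\in\mathbb R^{n_2}}\{q(\xi)^{T}y:\ W(\xi)y\ge h(\xi)-T(\xi)x\},$$ with $Q(x,\xi)=+\infty$ if the second stage is infeasible. Here $q,W,T,h$ are measurable in $\xi$, and $W(\xi)\in\mathbb R^{m_2\times n_2}$. The $m_2$ second-stage constraints consist of constraints $\overline W(\xi)y\ge\overline h(\xi)-\overline T(\xi)x$ with index set $I$, and deterministic constraints $Dy\ge g-Cx$; for every $x\in X$ there is a $y$ with $Dy\ge g-Cx$. The recourse likelihood of $x$ is $\phi(x)=\mathbb P(F(x,\boldsymbol\xi)<\infty)$. Let $\xi^1,\dots,\xi^N$ be an i.i.d. sample of $\boldsymbol\xi$, and $\mathbb P^N$ its law. Let $P(\xi)=\{\alpha\in\mathbb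 R_+^{m_2}:W(\xi)^{T}\alpha=q(\xi)\}$ and $\bar P(\xi)=\{\alpha\in\mathbb R_+^{m_2}:W(\xi)^{T}\alpha=0,\ \sum_{i\in I}\alpha_i=1\}$, and let $\mathrm{EXT}$ denote the set of extreme points. A point $x$ is a basic optimal solution of the sample average approximation (SAA) if all $Q(x,\xi^j)$ are finite and $(x,(Q(x,\xi^j))_{j})$ is a basic optimal solution of the linear program in $(x,\Theta)\in\mathbb R^{n_1}\times\mathbb R^N$ $$\min\ c^{T}x+\frac1N\sum_{j=1}^N\Theta_j\quad\text{s.t.}\quad \Theta_j\ge\alpha^{T}(h(\xi^j)-T(\xi^j)x)\ (\alpha\in\mathrm{EXT}(P(\xi^j)),\ j\le N),$$ $$\alpha^{T}(h(\xi^j)-T(\xi^j)x)\le 0\ (\alpha\in\mathrm{EXT}(\bar P(\xi^j)),\ j\le N),\qquad Ax\le b,$$ that is, an optimal solution at which $n_1+N$ linearly independent constraints hold with equality. Let $\varepsilon,\beta\in(0,1)$ and $$B=\frac2\varepsilon\log\frac1\beta+\frac{4n_1n_2}{\varepsilon}\Bigl(\log\frac{m_2}{n_2+1}+1\Bigr)+\frac{2n_1}{\varepsilon}\Bigl(\log\bigl(\tfrac{m_1}{n_1}+2\bigr)+\log\frac2\varepsilon+1\Bigr)+2n_1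 .$$ (a) Let $N\ge B$, and let $x_N^*$ be a function of the sample such that, for almost every sample, $x_N^*$ is a basic optimal solution of the SAA. Then $\mathbb P^N(\phi(x_N^*)\ge 1-\varepsilon)\ge 1-\beta$ (and, if $x_N^*$ is not assumed measurable, the outer probability of $\phi(x_N^*)<1-\varepsilon$ is at most $\beta$). (b) The bound is of order $n_1n_2/\varepsilon$ up to logarithmic factors: $$B\le 8\,\frac{n_1n_2}{\varepsilon}\Bigl(\log\frac1\beta+\log\frac{m_2}{n_2+1}+\log\bigl(\tfrac{m_1}{n_1}+2\bigr)+\log\frac2\varepsilon+1\Bigr).$$ -/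

import Mathlib

open MeasureTheory
open scoped Matrix

noncomputable section

/-! ### Linear inequality systems and basic solutions -/

/-- A linear inequality `a ⬝ z ≤ β` in the variables `z : ι → ℝ`, stored as the pair `(a, β)`. -/
abbrev LinIneq (ι : Type) : Type := (ι → ℝ) × ℝ

/-- `z` satisfies all inequalities of the system `S`. -/
def IsFeasibleFor {ι : Type} [Fintype ι] (S : Set (LinIneq ι)) (z : ι → ℝ) : Prop :=
  ∀ k ∈ S, k.1 ⬝ᵥ z ≤ k.2

/-- `z` is a basic solution of the system `S`: it is the (unique) solution of a linear system formed
by as many linearly independent inequalities of `S` as there are variables, with the inequality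
signs replaced by equality signs. A basic solution need not be feasible. -/
def IsBasicSolution {ι : Type} [Fintype ι] (S : Set (LinIneq ι)) (z : ι → ℝ) : Prop :=
  ∃ k : ι → LinIneq ι, (∀ i, k i ∈ S) ∧ LinearIndependent ℝ (fun i => (k i).1) ∧
    ∀ i, (k i).1 ⬝ᵥ z = (k i).2

/-- `z` is a basic optimal solution of the linear program `min {o ⬝ z : z satisfies S}`. -/
def IsBasicOptimal {ι : Type} [Fintype ι] (o : ι → ℝ) (S : Set (LinIneq ι)) (z : ι → ℝ) : Prop :=
  IsBasicSolution S z ∧ IsFeasibleFor S z ∧ ∀ z', IsFeasibleFor S z' → o ⬝ᵥ z ≤ o ⬝ᵥ z'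

/-! ### Two-stage stochastic linear programs -/

/-- The data of a two-stage stochastic linear program with `n₁` first-stage variables,
`n₂` second-stage variables, first-stage feasible region `X = {x | A x ≤ b}` given by `m₁`
inequalities, and a random vector with values in `ℝ^d`. The second-stage constraints are `p`
constraints `Wbar(ξ) y ≥ hbar(ξ) - Tbar(ξ) x` that may depend on `ξ`, followed by `r`
deterministic constraints `D y ≥ g - C x`. -/
structure TwoStageSLP (n₁ n₂ m₁ p r d : ℕ) where
  c : Fin n₁ → ℝ
  A : Matrix (Fin m₁) (Fin n₁) ℝ
  b : Fin m₁ → ℝ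
  q : (Fin d → ℝ) → Fin n₂ → ℝ
  Wbar : (Fin d → ℝ) → Matrix (Fin p) (Fin n₂) ℝ
  hbar : (Fin d → ℝ) → Fin p → ℝ
  Tbar : (Fin d → ℝ) → Matrix (Fin p) (Fin n₁) ℝ
  D : Matrix (Fin r) (Fin n₂) ℝ
  g : Fin r → ℝ
  C : Matrix (Fin r) (Fin n₁) ℝ

namespace TwoStageSLP

variable {n₁ n₂ m₁ p r d : ℕ} (S : TwoStageSLP n₁ n₂ m₁ p r d)

/-- The first-stage feasible region `X = {x | A x ≤ b}`. -/
def X : Set (Fin n₁ → ℝ) := {x | S.A *ᵥ x ≤ S.b}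

/-- All random data depend measurably on the realization `ξ`, entry by entry. -/
def MeasurableData : Prop :=
  (∀ k, Measurable fun ξ => S.q ξ k) ∧ (∀ i k, Measurable fun ξ => S.Wbar ξ i k) ∧
    (∀ i, Measurable fun ξ => S.hbar ξ i) ∧ ∀ i k, Measurable fun ξ => S.Tbar ξ i k

/-- For every `x ∈ X` the deterministic second-stage constraints alone are feasible. -/
def DetFeasible : Prop :=
  ∀ x ∈ S.X, ∃ y : Fin n₂ → ℝ, S.g - S.C *ᵥ x ≤ S.D *ᵥ y

/-- The full recourse matrix `W(ξ)`, with `m₂ = p + r` rows. -/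
def W (ξ : Fin d → ℝ) : Matrix (Fin p ⊕ Fin r) (Fin n₂) ℝ := Matrix.fromRows (S.Wbar ξ) S.D

/-- The full right-hand side `h(ξ)`. -/
def h (ξ : Fin d → ℝ) : Fin p ⊕ Fin r → ℝ := Sum.elim (S.hbar ξ) S.g

/-- The full technology matrix `T(ξ)`. -/
def T (ξ : Fin d → ℝ) : Matrix (Fin p ⊕ Fin r) (Fin n₁) ℝ := Matrix.fromRows (S.Tbar ξ) S.C

/-- The second-stage value `Q(x, ξ) = min {q(ξ)ᵀ y : W(ξ) y ≥ h(ξ) - T(ξ) x}`,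
equal to `+∞` when the second stage is infeasible. -/
def Q (x : Fin n₁ → ℝ) (ξ : Fin d → ℝ) : EReal :=
  ⨅ y ∈ {y : Fin n₂ → ℝ | S.h ξ - S.T ξ *ᵥ x ≤ S.W ξ *ᵥ y}, ((S.q ξ ⬝ᵥ y : ℝ) : EReal)

/-- The total cost `F(x, ξ) = cᵀ x + Q(x, ξ)`. -/
def F (x : Fin n₁ → ℝ) (ξ : Fin d → ℝ) : EReal := ((S.c ⬝ᵥ x : ℝ) : EReal) + S.Q x ξ

/-- The recourse likelihood `φ(x) = ℙ(F(x, ξ) < ∞)` for a random vector `ξ` on `(Ω, ℙ)`. -/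
def recourseLikelihood {Ω : Type*} [MeasurableSpace Ω] (P : Measure Ω) (ξ : Ω → Fin d → ℝ)
    (x : Fin n₁ → ℝ) : ℝ :=
  P.real {ω | S.F x (ξ ω) < ⊤}

/-- The dual polyhedron `P(ξ) = {α ≥ 0 : W(ξ)ᵀ α = q(ξ)}` of the second-stage problem. -/
def dualPoly (ξ : Fin d → ℝ) : Set (Fin p ⊕ Fin r → ℝ) :=
  {α | 0 ≤ α ∧ (S.W ξ)ᵀ *ᵥ α = S.q ξ}

/-- The dual polyhedron of the feasibility problem: `α ≥ 0`, `W(ξ)ᵀ α = 0` and the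
components of `α` that belong to the constraints depending on `ξ` sum to `1`. -/
def feasDualPoly (ξ : Fin d → ℝ) : Set (Fin p ⊕ Fin r → ℝ) :=
  {α | 0 ≤ α ∧ (S.W ξ)ᵀ *ᵥ α = 0 ∧ ∑ i : Fin p, α (Sum.inl i) = 1}

/-- The constraints of the Benders linear program of the sample average approximation, in the
variables `(x, Θ)`, for the sample `ξ¹, …, ξᴺ`:
`Θ_j ≥ αᵀ (h(ξʲ) - T(ξʲ) x)` for the extreme points `α` of `P(ξʲ)`,
`αᵀ (h(ξʲ) - T(ξʲ) x) ≤ 0` for the extreme points `α` of the feasibility dual, and `A x ≤ b`. -/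
def bendersSystem {N : ℕ} (s : Fin N → Fin d → ℝ) : Set (LinIneq (Fin n₁ ⊕ Fin N)) :=
  {k | ∃ j, ∃ α ∈ Set.extremePoints ℝ (S.dualPoly (s j)),
      k = (Sum.elim (-((S.T (s j))ᵀ *ᵥ α)) (-(Pi.single j 1)), -(α ⬝ᵥ S.h (s j)))} ∪
  {k | ∃ j, ∃ α ∈ Set.extremePoints ℝ (S.feasDualPoly (s j)),
      k = (Sum.elim (-((S.T (s j))ᵀ *ᵥ α)) 0, -(α ⬝ᵥ S.h (s j)))} ∪
  {k | ∃ i, k = (Sum.elim (S.A i) 0, S.b i)}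

/-- The objective `cᵀ x + N⁻¹ ∑_j Θ_j` of the Benders linear program. -/
def bendersObjective (N : ℕ) : Fin n₁ ⊕ Fin N → ℝ := Sum.elim S.c (fun _ => (N : ℝ)⁻¹)

/-- `x` is a basic optimal solution of the sample average approximation for the sample `s`:
`(x, (Q(x, ξʲ))_j)` is a basic optimal solution of the Benders linear program. -/
def IsBasicOptimalSAA {N : ℕ} (s : Fin N → Fin d → ℝ) (x : Fin n₁ → ℝ) : Prop :=
  ∃ Θ : Fin N → ℝ, (∀ j, ((Θ j : ℝ) : EReal) = S.Q x (s j)) ∧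
    IsBasicOptimal (S.bendersObjective N) (S.bendersSystem s) (Sum.elim x Θ)

end TwoStageSLP

/-- The sample size bound. -/
def sampleBound (n₁ n₂ m₁ m₂ : ℕ) (ε β : ℝ) : ℝ :=
  2 / ε * Real.log (1 / β)
    + 4 * n₁ * n₂ / ε * (Real.log (m₂ / (n₂ + 1)) + 1)
    + 2 * n₁ / ε * (Real.log (m₁ / n₁ + 2) + Real.log (2 / ε) + 1)
    + 2 * n₁

end

/-!
The first-stage part of a basic solution of the Benders program is determined by few sample points,
and a decision determined by few sample points generalizes to the others.

Compression. At a basic solution `(x, Θ)` the tight constraints have full rank, so every `Θ_j` occurs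
in a tight optimality cut. Eliminating each `Θ_j` through one such cut leaves equations in `x` alone:
differences of two optimality cuts of one sample point, feasibility cuts, and first-stage rows. They
determine `x` (`TwoStageSLP.eq_zero_of_orthogonal_tight`), so `n₁` independent ones among them do.
An extreme point of a dual polyhedron is determined by its support, since the corresponding rows are
linearly independent (`exists_eq_basicDual_of_mem_extremePoints`). Hence `x` is one of finitely many
measurable functions `TwoStageSLP.candidate K` of the sample, indexed by combinatorial selections
`K` of `n₁` equations, each depending on at most `n₁` sample points
(`TwoStageSLP.exists_eq_candidate`).

Generalization. For a fixed selection the other `N - n₁` sample points are independent of the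
candidate. If its recourse likelihood is below `1 - ε`, then all of them have a feasible second stage
with probability at most `(1 - ε) ^ (N - n₁)` (`pi_measure_setOf_forall_mem_le`). At an SAA solution
all second-stage values are finite, so a union bound over the selections bounds the probability of
failure. Only basicness and finiteness are used here, not optimality.

Counting. With `M` combinatorial types of equations per sample point there are
`(N M + m₁).choose n₁` selections, and `log M ≤ log 2 + 1 + 2 n₂ (log (m₂ / (n₂ + 1)) + 1)`
(`log_card_cutLabel_le`). The sample size bound makes the product of this number with
`(1 - ε) ^ (N - n₁)` at most `β` (`choose_mul_pow_le`).
-/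

noncomputable section

/-! ### Entrywise measurability of matrix operations -/

section MatrixMeasurability

variable {Ω : Type*} [MeasurableSpace Ω] {m n k : Type*} [Fintype n]

lemma measurable_dotProduct_apply {v w : Ω → n → ℝ} (hv : ∀ i, Measurable fun ω => v ω i)
    (hw : ∀ i, Measurable fun ω => w ω i) : Measurable fun ω => v ω ⬝ᵥ w ω := by
  unfold dotProduct
  exact Finset.measurable_fun_sum _ fun i _ => (hv i).mul (hw i)

lemma measurable_matrix_mulVec_apply {A : Ω → Matrix m n ℝ} {v : Ω → n → ℝ}
    (hA : ∀ i j, Measurable fun ω => A ω i j) (hv : ∀ i, Measurable fun ω => v ω i) (i : m) :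
    Measurable fun ω => (A ω *ᵥ v ω) i :=
  measurable_dotProduct_apply (hA i) hv

lemma measurable_matrix_mul_apply {A : Ω → Matrix m n ℝ} {B : Ω → Matrix n k ℝ}
    (hA : ∀ i j, Measurable fun ω => A ω i j) (hB : ∀ i j, Measurable fun ω => B ω i j)
    (i : m) (j : k) : Measurable fun ω => (A ω * B ω) i j :=
  measurable_dotProduct_apply (hA i) fun l => hB l j

variable [DecidableEq n]

lemma measurable_matrix_det {A : Ω → Matrix n n ℝ} (hA : ∀ i j, Measurable fun ω => A ω i j) :
    Measurable fun ω => (A ω).det := by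
  simp only [Matrix.det_apply']
  exact Finset.measurable_fun_sum _ fun σ _ =>
    measurable_const.mul (Finset.measurable_fun_prod _ fun i _ => hA _ _)

lemma measurable_matrix_inv_apply {A : Ω → Matrix n n ℝ}
    (hA : ∀ i j, Measurable fun ω => A ω i j) (i j : n) :
    Measurable fun ω => (A ω)⁻¹ i j := by
  simp only [Matrix.inv_def, Matrix.smul_apply, Ring.inverse_eq_inv', smul_eq_mul,
    Matrix.adjugate_apply]
  refine (measurable_matrix_det hA).inv.mul (measurable_matrix_det fun a b => ?_)
  simp only [Matrix.updateRow_apply]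
  split_ifs
  · exact measurable_const
  · exact hA a b

end MatrixMeasurability

/-! ### Extreme points of standard-form polyhedra -/

section BasicDual

variable {m k : Type*} [DecidableEq m] [Fintype k]

/-- The vector supported in `I` whose `I`-part is `(V_I V_Iᵀ)⁻¹ V_I v`, where `V_I` consists of the
rows of `V` in `I`. If these rows are linearly independent and `Vᵀ α = v` has a solution supported
in `I`, this is the only one. Unlike a choice of solution, the formula through the Gram matrix
is visibly measurable in `V` and `v`; it has no meaning for dependent rows, where the inverse is
`0` by convention. -/
def basicDual (V : Matrix m k ℝ) (v : k → ℝ) (I : Finset m) : m → ℝ := fun i =>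
  if hi : i ∈ I then
    ((V.submatrix (Subtype.val : I → m) id * (V.submatrix (Subtype.val : I → m) id)ᵀ)⁻¹ *ᵥ
      (V.submatrix (Subtype.val : I → m) id *ᵥ v)) ⟨i, hi⟩
  else 0

lemma measurable_basicDual_apply {Ω : Type*} [MeasurableSpace Ω] {V : Ω → Matrix m k ℝ}
    {v : Ω → k → ℝ} (hV : ∀ i j, Measurable fun ω => V ω i j) (hv : ∀ j, Measurable fun ω => v ω j)
    (I : Finset m) (i : m) : Measurable fun ω => basicDual (V ω) (v ω) I i := by
  unfold basicDual
  split_ifs with hi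
  · refine measurable_matrix_mulVec_apply (measurable_matrix_inv_apply
      (measurable_matrix_mul_apply ?_ ?_)) (measurable_matrix_mulVec_apply ?_ hv) _
    · exact fun a b => hV _ _
    · exact fun a b => hV _ _
    · exact fun a b => hV _ _
  · exact measurable_const

/-- Multiplying `V_Iᵀ α_I = v` by `V_I` gives a system with the Gram matrix of the rows in `I`, which
is nonsingular when these rows are linearly independent. -/
lemma eq_basicDual [Fintype m] {V : Matrix m k ℝ} {v : k → ℝ} {I : Finset m} {α : m → ℝ}
    (hsupp : ∀ i, i ∉ I → α i = 0) (hα : Vᵀ *ᵥ α = v)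
    (hind : LinearIndependent ℝ fun i : I => V i) : α = basicDual V v I := by
  set U : Matrix I k ℝ := V.submatrix (Subtype.val : I → m) id with hU
  have hUα : Uᵀ *ᵥ (fun i : I => α i) = v := by
    rw [← hα]
    ext j
    simp only [Matrix.mulVec, dotProduct, Matrix.transpose_apply, hU, Matrix.submatrix_apply, id]
    rw [Finset.sum_coe_sort I (fun i => V i j * α i)]
    exact Finset.sum_subset (Finset.subset_univ _) fun i _ hi => by simp [hsupp i hi]
  have hunit : IsUnit (U * Uᵀ) := by
    rw [← Matrix.mulVec_injective_iff_isUnit]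
    intro a b hab
    have h0 : (U * Uᴴ) *ᵥ (a - b) = 0 := by
      rw [Matrix.conjTranspose_eq_transpose_of_trivial, Matrix.mulVec_sub]
      exact sub_eq_zero.2 hab
    rw [Matrix.self_mul_conjTranspose_mulVec_eq_zero,
      Matrix.conjTranspose_eq_transpose_of_trivial] at h0
    have hinj : Function.Injective (Uᵀ).mulVec := by
      rw [Matrix.mulVec_injective_iff]
      exact hind
    exact sub_eq_zero.1 (hinj (by rw [h0, Matrix.mulVec_zero]))
  have hsol : (U * Uᵀ)⁻¹ *ᵥ (U *ᵥ v) = fun i : I => α i := by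
    rw [← hUα, Matrix.mulVec_mulVec, Matrix.mulVec_mulVec, Matrix.mul_assoc,
      Matrix.nonsing_inv_mul _ ((Matrix.isUnit_iff_isUnit_det _).1 hunit), Matrix.one_mulVec]
  ext i
  unfold basicDual
  split_ifs with hi
  · exact (congrFun hsol ⟨i, hi⟩).symm
  · exact hsupp i hi

/-- Extreme points of `{α ≥ 0 : Vᵀ α = v}` are basic: the rows of `V` in the support are linearly
independent, so there are at most as many of them as columns, and they determine the point. -/
lemma exists_eq_basicDual_of_mem_extremePoints [Fintype m] {V : Matrix m k ℝ} {v : k → ℝ}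
    {α : m → ℝ}
    (h : α ∈ Set.extremePoints ℝ {α : m → ℝ | 0 ≤ α ∧ Vᵀ *ᵥ α = v}) :
    ∃ I : Finset m, I.card ≤ Fintype.card k ∧ α = basicDual V v I := by
  obtain ⟨⟨hα0, hα⟩, hext⟩ := h
  set I : Finset m := Finset.univ.filter fun i => α i ≠ 0 with hI
  have hsupp : ∀ i, i ∉ I → α i = 0 := by
    intro i hi
    simpa [hI] using hi
  have hpos : ∀ i ∈ I, 0 < α i := fun i hi =>
    lt_of_le_of_ne (hα0 i) (Ne.symm (by simpa [hI] using hi))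
  have hind : LinearIndependent ℝ fun i : I => V i := by
    rw [Fintype.linearIndependent_iff]
    intro c hc
    -- A linear relation among the support rows, extended by zero, is a direction in which `α`
    -- can be moved both ways inside the polyhedron.
    set δ : m → ℝ := fun i => if hi : i ∈ I then c ⟨i, hi⟩ else 0 with hδ
    have hδV : Vᵀ *ᵥ δ = 0 := by
      ext j
      have hcj := congrFun hc j
      simp only [Finset.sum_apply, Pi.smul_apply, smul_eq_mul, Pi.zero_apply] at hcj
      simp only [Matrix.mulVec, dotProduct, Matrix.transpose_apply, Pi.zero_apply]
      rw [← hcj, ← Finset.sum_subset (Finset.subset_univ I) (fun i _ hi => by simp [hδ, hi]),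
        ← Finset.sum_coe_sort I]
      exact Finset.sum_congr rfl fun i _ => by simp [hδ, mul_comm]
    obtain ⟨t, ht, htI⟩ : ∃ t : ℝ, 0 < t ∧ ∀ i ∈ I, t * |δ i| ≤ α i := by
      have hev : ∀ᶠ t : ℝ in nhdsWithin 0 (Set.Ioi 0), ∀ i ∈ I, t * |δ i| ≤ α i := by
        rw [Filter.eventually_all_finset]
        intro i hi
        have hc : Filter.Tendsto (fun t : ℝ => t * |δ i|) (nhdsWithin 0 (Set.Ioi 0))
            (nhds (0 * |δ i|)) :=
          (((continuous_id.mul continuous_const).tendsto 0)).mono_left nhdsWithin_le_nhds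
        rw [zero_mul] at hc
        exact (hc.eventually (gt_mem_nhds (hpos i hi))).mono fun _ h => h.le
      obtain ⟨t, h1, h2⟩ := (hev.and self_mem_nhdsWithin).exists
      exact ⟨t, h2, h1⟩
    have hmem : ∀ σ : ℝ, |σ| = t → α + σ • δ ∈ {α : m → ℝ | 0 ≤ α ∧ Vᵀ *ᵥ α = v} := by
      intro σ hσ
      refine ⟨fun i => ?_, by rw [Matrix.mulVec_add, Matrix.mulVec_smul, hδV, hα]; simp⟩
      by_cases hi : i ∈ I
      · have h1 := htI i hi
        have h2 := neg_abs_le (σ * δ i)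
        rw [abs_mul, hσ] at h2
        simp only [Pi.zero_apply, Pi.add_apply, Pi.smul_apply, smul_eq_mul]
        linarith
      · simp [hδ, hi, hsupp i hi]
    have hseg : α ∈ openSegment ℝ (α + t • δ) (α + (-t) • δ) := by
      refine ⟨1 / 2, 1 / 2, by norm_num, by norm_num, by norm_num, ?_⟩
      ext i
      simp only [Pi.add_apply, Pi.smul_apply, smul_eq_mul]
      ring
    have heq := hext (hmem t (abs_of_pos ht)) (hmem (-t) (by rw [abs_neg, abs_of_pos ht])) hseg
    intro i
    have hi := congrFun heq i
    simp only [Pi.add_apply, Pi.smul_apply, smul_eq_mul] at hi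
    have hz : δ i = 0 := by
      rcases mul_eq_zero.1 (by linarith : t * δ i = 0) with h | h
      · exact absurd h ht.ne'
      · exact h
    simpa [hδ] using hz
  refine ⟨I, ?_, eq_basicDual hsupp hα hind⟩
  simpa using hind.fintype_card_le_finrank

end BasicDual

/-! ### Selecting a square nonsingular subsystem -/

/-- If only `0` is orthogonal to all vectors `v l` with `q l`, then some of these vectors form a
basis. -/
lemma exists_finset_linearIndependent_of_orthogonal {L n : Type*} [Finite L] [Fintype n]
    (v : L → n → ℝ) (q : L → Prop) (h : ∀ z : n → ℝ, (∀ l, q l → v l ⬝ᵥ z = 0) → z = 0) :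
    ∃ K : Finset L, K.card = Fintype.card n ∧ (∀ l ∈ K, q l) ∧
      LinearIndependent ℝ fun l : K => v l := by
  classical
  set u : {l // q l} → n → ℝ := fun l => v l with hu
  obtain ⟨κ, a, ha, hspan, hind⟩ := exists_linearIndependent' ℝ u
  have : Fintype L := Fintype.ofFinite L
  have : Finite κ := Finite.of_injective a ha
  have : Fintype κ := Fintype.ofFinite κ
  have hinj : Function.Injective (Matrix.mulVecLin (Matrix.of u)) := by
    rw [← LinearMap.ker_eq_bot, LinearMap.ker_eq_bot']
    exact fun z hz => h z fun l hl => congrFun hz ⟨l, hl⟩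
  have hrank : Module.finrank ℝ (Submodule.span ℝ (Set.range u)) = Fintype.card n := by
    have h1 := Matrix.rank_eq_finrank_span_row (Matrix.of u)
    have h2 : (Matrix.of u).rank = Fintype.card n := by
      rw [Matrix.rank, LinearMap.finrank_range_of_inj hinj, Module.finrank_pi]
    rw [← h2, h1]
    rfl
  have hcard : Fintype.card κ = Fintype.card n := by
    rw [← hrank, ← hspan, finrank_span_eq_card hind]
  have hb : Function.Injective fun i => (a i : L) := Subtype.val_injective.comp ha
  refine ⟨Finset.univ.image fun i => (a i : L), ?_, ?_, ?_⟩
  · rw [Finset.card_image_of_injective _ hb, Finset.card_univ, hcard]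
  · intro l hl
    obtain ⟨i, -, rfl⟩ := Finset.mem_image.1 hl
    exact (a i).2
  · have hex : ∀ l : Finset.univ.image (fun i => (a i : L)), ∃ i, (a i : L) = l := fun l => by
      obtain ⟨i, -, hi⟩ := Finset.mem_image.1 l.2
      exact ⟨i, hi⟩
    choose e he using hex
    have he_inj : Function.Injective e := fun l l' hll => by
      apply Subtype.ext
      rw [← he l, ← he l', hll]
    have heq : (fun l : Finset.univ.image (fun i => (a i : L)) => v l) = (u ∘ a) ∘ e := by
      funext l
      simp only [hu, Function.comp_apply, he]
    rw [heq]
    exact hind.comp e he_inj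

/-! ### Decisions determined by few sample points -/

/-- If the decision `f s` is determined by the sample points with index in `J`, then the remaining
points are independent of it, so a decision that satisfies a single random constraint with
probability at most `c` survives all of them with probability at most `c ^ (N - |J|)`. -/
lemma pi_measure_setOf_forall_mem_le {ι Ξ X : Type*} [Fintype ι] [MeasurableSpace Ξ]
    [MeasurableSpace X] (μ : Measure Ξ) [IsProbabilityMeasure μ] (J : Finset ι)
    {f : (ι → Ξ) → X} (hf : Measurable f) (hdep : DependsOn f (J : Set ι)) {G : Set (X × Ξ)}
    (hG : MeasurableSet G) (c : ENNReal) :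
    (Measure.pi fun _ : ι => μ) {s | μ (Prod.mk (f s) ⁻¹' G) ≤ c ∧ ∀ j, (f s, s j) ∈ G} ≤
      c ^ (Fintype.card ι - J.card) := by
  classical
  set B : Set (ι → Ξ) := {s | μ (Prod.mk (f s) ⁻¹' G) ≤ c ∧ ∀ j, (f s, s j) ∈ G} with hB
  have hBm : MeasurableSet B := by
    have hBeq : B = {s | μ (Prod.mk (f s) ⁻¹' G) ≤ c} ∩
        ⋂ j, (fun s : ι → Ξ => (f s, s j)) ⁻¹' G := by
      ext s
      simp [hB]
    rw [hBeq]
    exact (measurableSet_le ((measurable_measure_prodMk_left hG).comp hf) measurable_const).inter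
      (MeasurableSet.iInter fun j => (hf.prodMk (measurable_pi_apply j)) hG)
  let e := MeasurableEquiv.piEquivPiSubtypeProd (fun _ : ι => Ξ) (· ∈ J)
  have he := measurePreserving_piEquivPiSubtypeProd (fun _ : ι => μ) (· ∈ J)
  have hpre : e ⁻¹' (e.symm ⁻¹' B) = B := by
    ext s
    simp
  rw [← hpre, he.measure_preimage (e.symm.measurable hBm).nullMeasurableSet,
    Measure.prod_apply (e.symm.measurable hBm)]
  have hslice : ∀ a, (Measure.pi fun _ : {i // ¬ i ∈ J} => μ)
      (Prod.mk a ⁻¹' (e.symm ⁻¹' B)) ≤ c ^ (Fintype.card ι - J.card) := by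
    intro a
    rcases Set.eq_empty_or_nonempty (Prod.mk a ⁻¹' (e.symm ⁻¹' B)) with h | ⟨b₀, hb₀⟩
    · simp [h]
    have hx : ∀ b, f (e.symm (a, b)) = f (e.symm (a, b₀)) := by
      intro b
      refine hdep fun i hi => ?_
      have hi' : i ∈ J := hi
      simp [e, MeasurableEquiv.piEquivPiSubtypeProd, Equiv.piEquivPiSubtypeProd, hi']
    have hsub : Prod.mk a ⁻¹' (e.symm ⁻¹' B) ⊆
        Set.univ.pi fun _ : {i // ¬ i ∈ J} => Prod.mk (f (e.symm (a, b₀))) ⁻¹' G := by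
      intro b hb i _
      have h1 := hb.2 i
      rw [hx b] at h1
      have h2 : e.symm (a, b) i = b i := by
        simp [e, MeasurableEquiv.piEquivPiSubtypeProd, Equiv.piEquivPiSubtypeProd, i.2]
      rwa [h2] at h1
    calc _ ≤ _ := measure_mono hsub
      _ = μ (Prod.mk (f (e.symm (a, b₀))) ⁻¹' G) ^ (Fintype.card ι - J.card) := by
        rw [Measure.pi_pi, Finset.prod_const, Finset.card_univ, Fintype.card_subtype_compl,
          Fintype.card_coe]
      _ ≤ _ := pow_le_pow_left' hb₀.1 _
  refine (lintegral_mono hslice).trans ?_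
  simp

/-! ### Measurability of second-stage feasibility -/

/-- The solvable systems `z ≤ M y` form a countable union of closed sets: solvability within a
ball is a closed condition, since projections along compact sets are closed. -/
lemma measurableSet_exists_le_mulVec (m k : Type*) [Fintype m] [Fintype k] :
    MeasurableSet {a : (m → k → ℝ) × (m → ℝ) | ∃ y : k → ℝ, a.2 ≤ Matrix.of a.1 *ᵥ y} := by
  have hcl : ∀ n : ℕ, IsClosed {a : (m → k → ℝ) × (m → ℝ) |
      ∃ y ∈ Metric.closedBall (0 : k → ℝ) n, a.2 ≤ Matrix.of a.1 *ᵥ y} := by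
    intro n
    have : CompactSpace (Metric.closedBall (0 : k → ℝ) n) :=
      isCompact_iff_compactSpace.1 (isCompact_closedBall _ _)
    have h := isClosedMap_snd_of_compactSpace (X := Metric.closedBall (0 : k → ℝ) n)
      (Y := (m → k → ℝ) × (m → ℝ))
      {w | w.2.2 ≤ Matrix.of w.2.1 *ᵥ (w.1 : k → ℝ)} (by
        refine isClosed_le (by fun_prop) (continuous_pi fun i => ?_)
        simp only [Matrix.mulVec, dotProduct, Matrix.of_apply]
        exact continuous_finsetSum _ fun j _ =>
          ((continuous_apply_apply i j).comp (continuous_fst.comp continuous_snd)).mul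
            ((continuous_apply j).comp (continuous_subtype_val.comp continuous_fst)))
    convert h using 1
    ext a
    simp
  have : {a : (m → k → ℝ) × (m → ℝ) | ∃ y : k → ℝ, a.2 ≤ Matrix.of a.1 *ᵥ y} =
      ⋃ n : ℕ, {a | ∃ y ∈ Metric.closedBall (0 : k → ℝ) n, a.2 ≤ Matrix.of a.1 *ᵥ y} := by
    ext a
    simp only [Set.mem_ofPred_eq, Set.mem_iUnion, mem_closedBall_zero_iff]
    constructor
    · rintro ⟨y, hy⟩
      obtain ⟨n, hn⟩ := exists_nat_ge ‖y‖
      exact ⟨n, y, hn, hy⟩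
    · rintro ⟨n, y, -, hy⟩
      exact ⟨y, hy⟩
  rw [this]
  exact MeasurableSet.iUnion fun n => (hcl n).measurableSet

namespace TwoStageSLP

variable {n₁ n₂ m₁ p r d : ℕ} {S : TwoStageSLP n₁ n₂ m₁ p r d}

lemma MeasurableData.W_apply (hS : S.MeasurableData) (i : Fin p ⊕ Fin r) (j : Fin n₂) :
    Measurable fun ξ => S.W ξ i j := by
  rcases i with i | i
  · exact hS.2.1 i j
  · exact measurable_const

lemma MeasurableData.h_apply (hS : S.MeasurableData) (i : Fin p ⊕ Fin r) :
    Measurable fun ξ => S.h ξ i := by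
  rcases i with i | i
  · exact hS.2.2.1 i
  · exact measurable_const

lemma MeasurableData.T_apply (hS : S.MeasurableData) (i : Fin p ⊕ Fin r) (j : Fin n₁) :
    Measurable fun ξ => S.T ξ i j := by
  rcases i with i | i
  · exact hS.2.2.2 i j
  · exact measurable_const

lemma F_lt_top_iff (x : Fin n₁ → ℝ) (ξ : Fin d → ℝ) :
    S.F x ξ < ⊤ ↔ ∃ y : Fin n₂ → ℝ, S.h ξ - S.T ξ *ᵥ x ≤ S.W ξ *ᵥ y := by
  have h1 : S.F x ξ < ⊤ ↔ S.Q x ξ < ⊤ := by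
    unfold F
    constructor
    · intro h
      rw [lt_top_iff_ne_top] at h ⊢
      intro hQ
      exact h (by rw [hQ, EReal.coe_add_top])
    · exact fun h => EReal.add_lt_top (EReal.coe_ne_top _) h.ne
  rw [h1, Q]
  simp only [iInf_lt_iff, Set.mem_ofPred_eq, exists_prop]
  exact ⟨fun ⟨y, hy, _⟩ => ⟨y, hy⟩, fun ⟨y, hy⟩ => ⟨y, hy, EReal.coe_lt_top _⟩⟩

lemma measurableSet_F_lt_top (hS : S.MeasurableData) :
    MeasurableSet {a : (Fin n₁ → ℝ) × (Fin d → ℝ) | S.F a.1 a.2 < ⊤} := by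
  have hm : Measurable fun a : (Fin n₁ → ℝ) × (Fin d → ℝ) =>
      ((fun i j => S.W a.2 i j, fun i => S.h a.2 i - (S.T a.2 *ᵥ a.1) i) :
        (Fin p ⊕ Fin r → Fin n₂ → ℝ) × (Fin p ⊕ Fin r → ℝ)) := by
    refine Measurable.prodMk ?_ ?_
    · exact measurable_pi_lambda _ fun i => measurable_pi_lambda _ fun j =>
        (hS.W_apply i j).comp measurable_snd
    · exact measurable_pi_lambda _ fun i => ((hS.h_apply i).comp measurable_snd).sub
        (measurable_matrix_mulVec_apply (fun i j => (hS.T_apply i j).comp measurable_snd)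
          (fun j => (measurable_pi_apply j).comp measurable_fst) i)
  convert hm (measurableSet_exists_le_mulVec _ _) using 1
  ext a
  simp only [Set.mem_ofPred_eq, F_lt_top_iff]
  rfl

lemma recourseLikelihood_eq (hS : S.MeasurableData) {Ω : Type*} [MeasurableSpace Ω]
    (P : Measure Ω) {ξ : Ω → Fin d → ℝ} (hξ : AEMeasurable ξ P) (x : Fin n₁ → ℝ) :
    S.recourseLikelihood P ξ x =
      (P.map ξ).real (Prod.mk x ⁻¹' {a | S.F a.1 a.2 < ⊤}) := by
  unfold recourseLikelihood Measure.real
  rw [Measure.map_apply_of_aemeasurable hξ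
    (measurable_prodMk_left (measurableSet_F_lt_top hS))]
  rfl

end TwoStageSLP

/-! ### Compression of basic solutions of the Benders program -/

/-- The subsets of `m` with at most `n` elements: the possible supports of basic points.
Fewer than `n` elements are needed when the rows do not have full column rank. -/
abbrev SmallSubset (m : Type*) (n : ℕ) : Type _ := {I : Finset m // I.card ≤ n}

/-- The combinatorial types of the equations in `x` that a single sample point contributes: an
unordered pair of dual bases, whose optimality cuts are equated to eliminate `Θ_j`, or one basis
of the feasibility dual. -/
abbrev CutLabel (n₂ p r : ℕ) : Type :=
  {B : Finset (SmallSubset (Fin p ⊕ Fin r) n₂) // B.card = 2} ⊕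
    SmallSubset (Fin p ⊕ Fin r) (n₂ + 1)

/-- The combinatorial types of equations in `x`: those of the `N` sample points and the `m₁`
first-stage rows. -/
abbrev EqLabel (N n₂ m₁ p r : ℕ) : Type := (Fin N × CutLabel n₂ p r) ⊕ Fin m₁

/-- The selections of `n₁` equations. -/
abbrev EqSelection (N n₁ n₂ m₁ p r : ℕ) : Type :=
  {K : Finset (EqLabel N n₂ m₁ p r) // K.card = n₁}

lemma exists_eq_pair {α : Type*} (B : {B : Finset α // B.card = 2}) :
    ∃ a b : α, a ≠ b ∧ ∀ c, c ∈ B.1 ↔ c = a ∨ c = b := by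
  classical
  obtain ⟨a, b, hab, hB⟩ := Finset.card_eq_two.1 B.2
  exact ⟨a, b, hab, fun c => by simp [hB]⟩

/-- One member of a two-element set. -/
def pairFst {α : Type*} (B : {B : Finset α // B.card = 2}) : α := (exists_eq_pair B).choose

/-- The other member of a two-element set. -/
def pairSnd {α : Type*} (B : {B : Finset α // B.card = 2}) : α :=
  (exists_eq_pair B).choose_spec.choose

lemma exists_pair_eq {α : Type*} {a b : α} (h : a ≠ b) :
    ∃ B : {B : Finset α // B.card = 2},
      (pairFst B = a ∧ pairSnd B = b) ∨ (pairFst B = b ∧ pairSnd B = a) := by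
  classical
  refine ⟨⟨{a, b}, Finset.card_pair h⟩, ?_⟩
  set B : {B : Finset α // B.card = 2} := ⟨{a, b}, Finset.card_pair h⟩ with hB
  have hspec : pairFst B ≠ pairSnd B ∧ ∀ c, c ∈ B.1 ↔ c = pairFst B ∨ c = pairSnd B :=
    (exists_eq_pair B).choose_spec.choose_spec
  have h1 : pairFst B ∈ ({a, b} : Finset α) := (hspec.2 _).2 (Or.inl rfl)
  have h2 : pairSnd B ∈ ({a, b} : Finset α) := (hspec.2 _).2 (Or.inr rfl)
  simp only [Finset.mem_insert, Finset.mem_singleton] at h1 h2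
  rcases h1 with h1 | h1 <;> rcases h2 with h2 | h2
  · exact absurd (h1.trans h2.symm) hspec.1
  · exact Or.inl ⟨h1, h2⟩
  · exact Or.inr ⟨h1, h2⟩
  · exact absurd (h1.trans h2.symm) hspec.1

namespace TwoStageSLP

variable {n₁ n₂ m₁ p r d : ℕ} (S : TwoStageSLP n₁ n₂ m₁ p r d)

/-- `W(ξ)` with one more column, the indicator of the constraints depending on `ξ`; it writes the
feasibility dual in standard form. -/
def feasMatrix (ξ : Fin d → ℝ) : Matrix (Fin p ⊕ Fin r) (Fin n₂ ⊕ Unit) ℝ :=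
  Matrix.of fun i => Sum.elim (S.W ξ i) fun _ => Sum.elim 1 0 i

/-- The candidate for the extreme point of `P(ξ)` with support in `I`. -/
def optDual (ξ : Fin d → ℝ) (I : Finset (Fin p ⊕ Fin r)) : Fin p ⊕ Fin r → ℝ :=
  basicDual (S.W ξ) (S.q ξ) I

/-- The candidate for the extreme point of the feasibility dual with support in `I`. -/
def feasDual (ξ : Fin d → ℝ) (I : Finset (Fin p ⊕ Fin r)) : Fin p ⊕ Fin r → ℝ :=
  basicDual (S.feasMatrix ξ) (Sum.elim 0 1) I

lemma exists_eq_optDual {ξ : Fin d → ℝ} {α : Fin p ⊕ Fin r → ℝ}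
    (h : α ∈ Set.extremePoints ℝ (S.dualPoly ξ)) :
    ∃ I : SmallSubset (Fin p ⊕ Fin r) n₂, α = S.optDual ξ I := by
  obtain ⟨I, hI, h⟩ := exists_eq_basicDual_of_mem_extremePoints h
  exact ⟨⟨I, by simpa using hI⟩, h⟩

lemma feasDualPoly_eq (ξ : Fin d → ℝ) :
    S.feasDualPoly ξ = {α | 0 ≤ α ∧ (S.feasMatrix ξ)ᵀ *ᵥ α =
      (Sum.elim 0 1 : Fin n₂ ⊕ Unit → ℝ)} := by
  ext α
  have h1 : (S.feasMatrix ξ)ᵀ *ᵥ α =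
      Sum.elim ((S.W ξ)ᵀ *ᵥ α) fun _ => ∑ i : Fin p, α (Sum.inl i) := by
    ext (j | j)
    · simp [Matrix.mulVec, dotProduct, feasMatrix]
    · simp [Matrix.mulVec, dotProduct, feasMatrix]
  have h2 : (fun _ : Unit => ∑ i : Fin p, α (Sum.inl i)) = 1 ↔ ∑ i : Fin p, α (Sum.inl i) = 1 :=
    ⟨fun h => congrFun h (), fun h => funext fun _ => h⟩
  simp only [feasDualPoly, Set.mem_ofPred_eq, h1, Sum.elim_eq_iff, h2]

lemma exists_eq_feasDual {ξ : Fin d → ℝ} {α : Fin p ⊕ Fin r → ℝ}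
    (h : α ∈ Set.extremePoints ℝ (S.feasDualPoly ξ)) :
    ∃ I : SmallSubset (Fin p ⊕ Fin r) (n₂ + 1), α = S.feasDual ξ I := by
  rw [feasDualPoly_eq] at h
  obtain ⟨I, hI, h⟩ := exists_eq_basicDual_of_mem_extremePoints h
  exact ⟨⟨I, by simpa using hI⟩, h⟩

/-- The multiplier `α` of the equation `αᵀ (h(ξ) - T(ξ) x) = 0` labelled by `l`. -/
def cutMultiplier (ξ : Fin d → ℝ) : CutLabel n₂ p r → Fin p ⊕ Fin r → ℝ
  | Sum.inl B => S.optDual ξ (pairFst B).1 - S.optDual ξ (pairSnd B).1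
  | Sum.inr I => S.feasDual ξ I.1

/-- The coefficients and the right-hand side of the equation in `x` with a given label. -/
def labelEq {N : ℕ} (s : Fin N → Fin d → ℝ) : EqLabel N n₂ m₁ p r → LinIneq (Fin n₁)
  | Sum.inl (j, l) => ((S.T (s j))ᵀ *ᵥ S.cutMultiplier (s j) l,
      S.cutMultiplier (s j) l ⬝ᵥ S.h (s j))
  | Sum.inr i => (S.A i, S.b i)

/-- The solution of the `n₁` selected equations (with value `0` if they are dependent, the
convention for the inverse of a singular matrix). -/
def candidate {N : ℕ} (K : EqSelection N n₁ n₂ m₁ p r) (s : Fin N → Fin d → ℝ) : Fin n₁ → ℝ :=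
  (Matrix.of fun i => (S.labelEq s ((Finset.equivFinOfCardEq K.2).symm i)).1)⁻¹ *ᵥ
    fun i => (S.labelEq s ((Finset.equivFinOfCardEq K.2).symm i)).2

variable {S}

lemma measurable_cutMultiplier_apply (hS : S.MeasurableData) (l : CutLabel n₂ p r)
    (i : Fin p ⊕ Fin r) : Measurable fun ξ => S.cutMultiplier ξ l i := by
  rcases l with B | I
  · have hI : ∀ I, Measurable fun ξ => S.optDual ξ I i := fun I =>
      measurable_basicDual_apply hS.W_apply hS.1 I i
    exact (hI _).sub (hI _)
  · have hV : ∀ i j, Measurable fun ξ => S.feasMatrix ξ i j := by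
      rintro i (j | j)
      · exact hS.W_apply i j
      · exact measurable_const
    have hI : ∀ I, Measurable fun ξ => S.feasDual ξ I i := fun I =>
      measurable_basicDual_apply (V := S.feasMatrix) (v := fun _ => Sum.elim 0 1) hV
        (fun _ => measurable_const) I i
    exact hI I

lemma measurable_candidate (hS : S.MeasurableData) {N : ℕ} (K : EqSelection N n₁ n₂ m₁ p r) :
    Measurable (S.candidate K) := by
  have h1 : ∀ (l : EqLabel N n₂ m₁ p r) (k : Fin n₁),
      Measurable fun s : Fin N → Fin d → ℝ => (S.labelEq s l).1 k := by
    rintro (⟨j, l⟩ | i) k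
    · exact (measurable_matrix_mulVec_apply (fun a b => hS.T_apply b a)
        (measurable_cutMultiplier_apply hS l) k).comp (measurable_pi_apply j)
    · exact measurable_const
  have h2 : ∀ l : EqLabel N n₂ m₁ p r,
      Measurable fun s : Fin N → Fin d → ℝ => (S.labelEq s l).2 := by
    rintro (⟨j, l⟩ | i)
    · exact (measurable_dotProduct_apply (measurable_cutMultiplier_apply hS l)
        hS.h_apply).comp (measurable_pi_apply j)
    · exact measurable_const
  exact measurable_pi_lambda _ fun i => measurable_matrix_mulVec_apply
    (measurable_matrix_inv_apply fun a b => h1 _ b) (fun a => h2 _) i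

lemma dependsOn_candidate {N : ℕ} (K : EqSelection N n₁ n₂ m₁ p r) :
    DependsOn (S.candidate K) (K.1.toLeft.image Prod.fst : Finset (Fin N)) := by
  intro s s' hs
  have h : ∀ l ∈ K.1, S.labelEq s l = S.labelEq s' l := by
    rintro (⟨j, l⟩ | i) hl
    · have hj : s j = s' j := hs j (by
        simp only [Finset.coe_image, Set.mem_image, Finset.mem_coe, Finset.mem_toLeft]
        exact ⟨(j, l), hl, rfl⟩)
      simp only [labelEq, hj]
    · rfl
  unfold candidate
  simp only [h _ (Subtype.coe_prop _)]

lemma card_sampleIndices_le {N : ℕ} (K : EqSelection N n₁ n₂ m₁ p r) :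
    (K.1.toLeft.image Prod.fst : Finset (Fin N)).card ≤ n₁ :=
  Finset.card_image_le.trans (K.1.card_toLeft_le.trans K.2.le)

/-- The equations in `x` that hold at a basic solution `(x, Θ)` determine `x`: a direction `z`
along which they all persist extends, through one tight optimality cut for each sample point, to a
direction `(z, w)` along which every tight constraint of the Benders program persists. -/
lemma eq_zero_of_orthogonal_tight {N : ℕ} {s : Fin N → Fin d → ℝ} {x : Fin n₁ → ℝ}
    {Θ : Fin N → ℝ} (hx : IsBasicSolution (S.bendersSystem s) (Sum.elim x Θ)) (z : Fin n₁ → ℝ)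
    (hz : ∀ l, (S.labelEq s l).1 ⬝ᵥ x = (S.labelEq s l).2 → (S.labelEq s l).1 ⬝ᵥ z = 0) :
    z = 0 := by
  obtain ⟨k, hk, hind, htight⟩ := hx
  have hfull : ∀ v : Fin n₁ ⊕ Fin N → ℝ, (∀ i, (k i).1 ⬝ᵥ v = 0) → v = 0 := by
    intro v hv
    have hu : IsUnit (Matrix.of fun i => (k i).1) :=
      Matrix.linearIndependent_rows_iff_isUnit.1 hind
    refine Matrix.mulVec_injective_iff_isUnit.2 hu ?_
    rw [Matrix.mulVec_zero]
    exact funext hv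
  have hopt : ∀ j, ∃ I : SmallSubset (Fin p ⊕ Fin r) n₂,
      ((S.T (s j))ᵀ *ᵥ S.optDual (s j) I) ⬝ᵥ x + Θ j = S.optDual (s j) I ⬝ᵥ S.h (s j) := by
    intro j
    by_contra! hno
    have h0 := hfull (Sum.elim 0 (Pi.single j 1)) fun i => by
      have ht := htight i
      rcases hk i with (⟨j', α, hα, hki⟩ | ⟨j', α, hα, hki⟩) | ⟨i', hki⟩
      · obtain ⟨I, rfl⟩ := S.exists_eq_optDual hα
        rw [hki] at ht ⊢
        simp only [sumElim_dotProduct_sumElim, neg_dotProduct, single_dotProduct] at ht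
        by_cases hj : j' = j
        · subst hj
          exact absurd (by linarith) (hno I)
        · simp [hj]
      · rw [hki]
        simp
      · rw [hki]
        simp
    have := congrFun h0 (Sum.inr j)
    simp at this
  choose I hI using hopt
  have h0 := hfull (Sum.elim z fun j => -(((S.T (s j))ᵀ *ᵥ S.optDual (s j) (I j)) ⬝ᵥ z))
    fun i => by
      have ht := htight i
      rcases hk i with (⟨j, α, hα, hki⟩ | ⟨j, α, hα, hki⟩) | ⟨i', hki⟩
      · obtain ⟨I', rfl⟩ := S.exists_eq_optDual hα
        rw [hki] at ht ⊢
        simp only [sumElim_dotProduct_sumElim, neg_dotProduct, single_dotProduct] at ht ⊢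
        have hIj := hI j
        by_cases hII : I' = I j
        · rw [hII]
          ring
        · obtain ⟨B, hB⟩ := exists_pair_eq hII
          have hzB := hz (Sum.inl (j, Sum.inl B))
          rcases hB with ⟨hB1, hB2⟩ | ⟨hB1, hB2⟩ <;>
          · simp only [labelEq, cutMultiplier, hB1, hB2, Matrix.mulVec_sub, sub_dotProduct] at hzB
            have := hzB (by linarith)
            linarith
      · obtain ⟨I', rfl⟩ := S.exists_eq_feasDual hα
        rw [hki] at ht ⊢
        simp only [sumElim_dotProduct_sumElim, neg_dotProduct, zero_dotProduct] at ht ⊢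
        have := hz (Sum.inl (j, Sum.inr I')) (by simp only [labelEq, cutMultiplier]; linarith)
        simp only [labelEq, cutMultiplier] at this
        linarith
      · rw [hki] at ht ⊢
        simp only [sumElim_dotProduct_sumElim, zero_dotProduct, add_zero] at ht ⊢
        exact hz (Sum.inr i') ht
  exact funext fun i => congrFun h0 (Sum.inl i)

/-- A basic solution of the Benders program is the candidate of one of the selections of `n₁`
equations. -/
lemma exists_eq_candidate {N : ℕ} {s : Fin N → Fin d → ℝ} {x : Fin n₁ → ℝ} {Θ : Fin N → ℝ}
    (hx : IsBasicSolution (S.bendersSystem s) (Sum.elim x Θ)) :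
    ∃ K : EqSelection N n₁ n₂ m₁ p r, x = S.candidate K s := by
  obtain ⟨K, hK, hKx, hind⟩ := exists_finset_linearIndependent_of_orthogonal
    (fun l => (S.labelEq s l).1) (fun l => (S.labelEq s l).1 ⬝ᵥ x = (S.labelEq s l).2)
    (eq_zero_of_orthogonal_tight hx)
  rw [Fintype.card_fin] at hK
  refine ⟨⟨K, hK⟩, ?_⟩
  set e := (Finset.equivFinOfCardEq hK).symm with he
  set M : Matrix (Fin n₁) (Fin n₁) ℝ := Matrix.of fun i => (S.labelEq s (e i)).1 with hM
  have hu : IsUnit M :=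
    Matrix.linearIndependent_rows_iff_isUnit.1 (hind.comp e e.injective)
  have hMx : M *ᵥ x = fun i => (S.labelEq s (e i)).2 := funext fun i => hKx _ (e i).2
  change x = M⁻¹ *ᵥ fun i => (S.labelEq s (e i)).2
  rw [← hMx, Matrix.mulVec_mulVec, Matrix.nonsing_inv_mul _ ((Matrix.isUnit_iff_isUnit_det _).1 hu),
    Matrix.one_mulVec]

/-- The union bound over the selections: almost surely `xstar s` is a candidate at which the second
stage is feasible for all sample points. The set on the left need not be measurable; it is covered
by the measurable events of the selections. -/
lemma measure_recourseLikelihood_lt_le (hS : S.MeasurableData) {Ω : Type*} [MeasurableSpace Ω]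
    (P : Measure Ω) [IsProbabilityMeasure P] {ξ : Ω → Fin d → ℝ} (hξ : AEMeasurable ξ P)
    {ε : ℝ} (hε : ε ∈ Set.Ioo (0 : ℝ) 1) {N : ℕ} {xstar : (Fin N → Fin d → ℝ) → Fin n₁ → ℝ}
    (hxstar : ∀ᵐ s ∂(Measure.pi fun _ : Fin N => P.map ξ), S.IsBasicOptimalSAA s (xstar s)) :
    (Measure.pi fun _ : Fin N => P.map ξ)
        {s | S.recourseLikelihood P ξ (xstar s) < 1 - ε} ≤
      ENNReal.ofReal ((Fintype.card (EqSelection N n₁ n₂ m₁ p r) : ℝ) * (1 - ε) ^ (N - n₁)) := by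
  have : IsProbabilityMeasure (P.map ξ) := Measure.isProbabilityMeasure_map hξ
  set G : Set ((Fin n₁ → ℝ) × (Fin d → ℝ)) := {a | S.F a.1 a.2 < ⊤} with hG
  set c : ENNReal := ENNReal.ofReal (1 - ε) with hc
  have hc1 : c ≤ 1 := by
    rw [hc, ENNReal.ofReal_le_one]
    linarith [hε.1]
  have hsub : {s | S.recourseLikelihood P ξ (xstar s) < 1 - ε} ≤ᵐ[Measure.pi fun _ : Fin N =>
      P.map ξ] ⋃ K : EqSelection N n₁ n₂ m₁ p r,
        {s | (P.map ξ) (Prod.mk (S.candidate K s) ⁻¹' G) ≤ c ∧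
          ∀ j, (S.candidate K s, s j) ∈ G} := by
    filter_upwards [hxstar] with s hs hlt
    obtain ⟨Θ, hΘ, hbasic, -⟩ := hs
    obtain ⟨K, hK⟩ := exists_eq_candidate hbasic
    refine Set.mem_iUnion.2 ⟨K, ?_, fun j => ?_⟩
    · rw [← hK, hc, ← ENNReal.ofReal_toReal (measure_ne_top (P.map ξ) _)]
      refine ENNReal.ofReal_le_ofReal ?_
      have h1 : S.recourseLikelihood P ξ (xstar s) < 1 - ε := hlt
      rw [recourseLikelihood_eq hS P hξ] at h1
      exact h1.le
    · change S.F (S.candidate K s) (s j) < ⊤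
      rw [← hK, F, ← hΘ j, ← EReal.coe_add]
      exact EReal.coe_lt_top _
  calc _ ≤ _ := measure_mono_ae hsub
    _ ≤ ∑ K : EqSelection N n₁ n₂ m₁ p r, (Measure.pi fun _ : Fin N => P.map ξ)
        {s | (P.map ξ) (Prod.mk (S.candidate K s) ⁻¹' G) ≤ c ∧
          ∀ j, (S.candidate K s, s j) ∈ G} := measure_iUnion_fintype_le _ _
    _ ≤ ∑ _K : EqSelection N n₁ n₂ m₁ p r, c ^ (N - n₁) := by
        refine Finset.sum_le_sum fun K _ => ?_
        refine (pi_measure_setOf_forall_mem_le (P.map ξ) _ (measurable_candidate hS K)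
          (dependsOn_candidate K) (measurableSet_F_lt_top hS) c).trans ?_
        refine pow_le_pow_right_of_le_one' hc1 ?_
        rw [Fintype.card_fin]
        exact Nat.sub_le_sub_left (card_sampleIndices_le K) N
    _ = _ := by
        rw [Finset.sum_const, Finset.card_univ, nsmul_eq_mul, hc,
          ENNReal.ofReal_mul (Nat.cast_nonneg _), ENNReal.ofReal_natCast,
          ENNReal.ofReal_pow (by linarith [hε.2])]

end TwoStageSLP

/-! ### Counting selections -/

lemma card_smallSubset_le (m : Type*) [Fintype m] (n : ℕ) {u : ℝ} (hu : 1 ≤ u) :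
    (Fintype.card (SmallSubset m n) : ℝ) ≤ u ^ n * Real.exp (Fintype.card m / u) := by
  classical
  have hu0 : 0 < u := by linarith
  -- Each subset counted is given the weight `u ^ (n - |I|) ≥ 1`; over all subsets these weights
  -- sum to `u ^ n * (1 + u⁻¹) ^ |m|`.
  have h1 : (Fintype.card (SmallSubset m n) : ℝ) ≤
      ∑ I ∈ (Finset.univ : Finset m).powerset, u ^ n * (u⁻¹ ^ I.card * 1 ^ (Fintype.card m - I.card))
      := by
    rw [Fintype.card_subtype, Finset.cast_card, Finset.powerset_univ]
    refine (Finset.sum_le_sum fun I hI => ?_).trans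
      (Finset.sum_le_sum_of_subset_of_nonneg (Finset.filter_subset _ _) fun I _ _ => by positivity)
    have hI' : I.card ≤ n := by simpa using hI
    rw [one_pow, mul_one, inv_pow, ← div_eq_mul_inv, one_le_div (by positivity)]
    exact pow_le_pow_right₀ hu hI'
  refine h1.trans ?_
  rw [← Finset.mul_sum, ← Finset.card_univ, Finset.sum_pow_mul_eq_add_pow]
  refine mul_le_mul_of_nonneg_left ?_ (by positivity)
  calc (u⁻¹ + 1) ^ (Finset.univ : Finset m).card
      ≤ Real.exp u⁻¹ ^ (Finset.univ : Finset m).card :=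
        pow_le_pow_left₀ (by positivity) (Real.add_one_le_exp _) _
    _ = _ := by rw [← Real.exp_nat_mul, div_eq_mul_inv]

lemma one_le_card_cutLabel (n₂ p r : ℕ) : 1 ≤ Fintype.card (CutLabel n₂ p r) :=
  Fintype.card_pos_iff.2 ⟨Sum.inr ⟨∅, by simp⟩⟩

/-- With `a = (e m₂ / (n₂ + 1)) ^ n₂` there are at most `e a` bases for an optimality cut, hence
`e² a² / 2` pairs of them, and at most `a²` bases for a feasibility cut; finally
`e² / 2 + 1 ≤ 2 e`. -/
lemma log_card_cutLabel_le {n₂ m₂ p r : ℕ} (hn₂ : 1 ≤ n₂) (hpr : p + r = m₂)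
    (hm₂ : n₂ + 1 ≤ m₂) :
    Real.log (Fintype.card (CutLabel n₂ p r)) ≤
      Real.log 2 + 1 + 2 * n₂ * (Real.log (m₂ / (n₂ + 1)) + 1) := by
  set u : ℝ := m₂ / (n₂ + 1) with hu
  have hn0 : (0 : ℝ) < n₂ + 1 := by positivity
  have hm0 : (n₂ : ℝ) + 1 ≤ m₂ := by exact_mod_cast hm₂
  have hu1 : 1 ≤ u := (one_le_div hn0).2 hm0
  have hmu : (m₂ : ℝ) / u = (n₂ + 1 : ℕ) := by
    rw [hu, Nat.cast_add, Nat.cast_one]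
    have : (m₂ : ℝ) ≠ 0 := by linarith
    field_simp
  have hcard : Fintype.card (Fin p ⊕ Fin r) = m₂ := by simp [hpr]
  have hexp : Real.exp ((n₂ + 1 : ℕ) : ℝ) = Real.exp 1 ^ (n₂ + 1) := by
    rw [← Real.exp_nat_mul, mul_one]
  set w : ℝ := Real.exp 1 * u with hw
  have he1 := Real.exp_one_gt_d9
  have he2 := Real.exp_one_lt_d9
  have hw1 : 1 ≤ w := by nlinarith
  have h0 : (Fintype.card (SmallSubset (Fin p ⊕ Fin r) n₂) : ℝ) ≤ Real.exp 1 * w ^ n₂ := by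
    refine (card_smallSubset_le _ n₂ hu1).trans_eq ?_
    rw [hcard, hmu, hexp, hw, mul_pow]
    ring
  have h1 : (Fintype.card (SmallSubset (Fin p ⊕ Fin r) (n₂ + 1)) : ℝ) ≤ (w ^ n₂) ^ 2 := by
    refine (card_smallSubset_le _ (n₂ + 1) hu1).trans ?_
    rw [hcard, hmu, hexp, mul_comm, ← mul_pow, ← hw, ← pow_mul]
    exact pow_le_pow_right₀ hw1 (by omega)
  have h2 : (Fintype.card (CutLabel n₂ p r) : ℝ) ≤ 2 * Real.exp 1 * (w ^ n₂) ^ 2 := by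
    have hch := Nat.choose_le_pow_div (α := ℝ) 2 (Fintype.card (SmallSubset (Fin p ⊕ Fin r) n₂))
    have hsq : (Fintype.card (SmallSubset (Fin p ⊕ Fin r) n₂) : ℝ) ^ 2 ≤
        (Real.exp 1 * w ^ n₂) ^ 2 := pow_le_pow_left₀ (Nat.cast_nonneg _) h0 2
    rw [Fintype.card_sum, Fintype.card_finset_len, Nat.cast_add]
    rw [Nat.factorial_two, Nat.cast_two] at hch
    have hE : Real.exp 1 ^ 2 / 2 + 1 ≤ 2 * Real.exp 1 := by nlinarith
    have := mul_le_mul_of_nonneg_right hE (by positivity : 0 ≤ (w ^ n₂) ^ 2)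
    rw [mul_pow] at hsq
    linarith
  have hpos : (0 : ℝ) < Fintype.card (CutLabel n₂ p r) := by
    exact_mod_cast one_le_card_cutLabel n₂ p r
  have hw0 : 0 < w := by linarith
  refine (Real.log_le_log hpos h2).trans_eq ?_
  rw [Real.log_mul (by positivity) (by positivity), Real.log_mul (by norm_num) (by positivity),
    Real.log_exp, Real.log_pow, Real.log_pow, hw, Real.log_mul (by positivity) (by positivity),
    Real.log_exp]
  push_cast
  ring

lemma card_eqSelection (N n₁ n₂ m₁ p r : ℕ) :
    Fintype.card (EqSelection N n₁ n₂ m₁ p r) =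
      (N * Fintype.card (CutLabel n₂ p r) + m₁).choose n₁ := by
  rw [Fintype.card_finset_len, Fintype.card_sum, Fintype.card_prod, Fintype.card_fin,
    Fintype.card_fin]

/-! ### The sample size bound -/

lemma choose_le_exp {K n : ℕ} (hK : 1 ≤ K) (hn : 1 ≤ n) :
    (K.choose n : ℝ) ≤ Real.exp (n * (1 + Real.log (K / n))) := by
  have hn0 : (0 : ℝ) < n := by exact_mod_cast hn
  have hK0 : (0 : ℝ) < K := by exact_mod_cast hK
  have h := Real.pow_div_factorial_le_exp (n : ℝ) hn0.le n
  calc (K.choose n : ℝ) ≤ (K : ℝ) ^ n / n.factorial := Nat.choose_le_pow_div n K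
    _ = ((K : ℝ) / n) ^ n * ((n : ℝ) ^ n / n.factorial) := by
        rw [div_pow]
        field_simp
    _ ≤ ((K : ℝ) / n) ^ n * Real.exp n := mul_le_mul_of_nonneg_left h (by positivity)
    _ = _ := by
        rw [mul_add, mul_one, Real.exp_add, Real.exp_nat_mul (Real.log (K / n)),
          Real.exp_log (by positivity), mul_comm]

/-- The binomial coefficient is at most `exp (n₁ (1 + log ((N M + m₁) / n₁)))`, the power is at
most `exp (-ε (N - n₁))`, and the inequality `log y ≤ y - 1` at `y = ε N / (2 n₁)` absorbs
`n₁ log (N / n₁)` into half of the decay `ε N`. -/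
lemma choose_mul_pow_le {N M n₁ m₁ : ℕ} {ε β l : ℝ} (hn₁ : 1 ≤ n₁) (hM : 1 ≤ M)
    (hε : ε ∈ Set.Ioo (0 : ℝ) 1) (hβ : 0 < β) (hN : 2 * n₁ ≤ N)
    (hl : Real.log M ≤ Real.log 2 + 1 + l)
    (hbound : 2 * Real.log (1 / β) + 2 * n₁ * l +
      2 * n₁ * (Real.log (m₁ / n₁ + 2) + Real.log (2 / ε) + 1) + 2 * n₁ * ε ≤ ε * N) :
    ((N * M + m₁).choose n₁ : ℝ) * (1 - ε) ^ (N - n₁) ≤ β := by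
  obtain ⟨hε0, hε1⟩ := hε
  have hn0 : (0 : ℝ) < n₁ := by exact_mod_cast hn₁
  have hM1 : (1 : ℝ) ≤ M := by exact_mod_cast hM
  have hNn : 2 * (n₁ : ℝ) ≤ N := by exact_mod_cast hN
  have hN0 : (0 : ℝ) < N := by linarith
  have ht : (0 : ℝ) ≤ m₁ / n₁ := by positivity
  have hlogN : Real.log (N / n₁) ≤ ε * N / (2 * n₁) + Real.log (2 / ε) - 1 := by
    have h := Real.log_le_sub_one_of_pos (by positivity : 0 < ε * N / (2 * n₁))
    have heq : Real.log (N / n₁) = Real.log (ε * N / (2 * n₁)) + Real.log (2 / ε) := by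
      rw [← Real.log_mul (by positivity) (by positivity)]
      congr 1
      field_simp
    linarith
  have hR : ((N * M + m₁ : ℕ) : ℝ) / n₁ ≤ N / n₁ * M * ((m₁ / n₁ + 2) / 2) := by
    have h1 : 1 ≤ N * M / (2 * (n₁ : ℝ)) := by
      rw [one_le_div (by positivity)]
      nlinarith
    have h2 := mul_le_mul_of_nonneg_right h1 ht
    have h3 : (N : ℝ) / n₁ * M * ((m₁ / n₁ + 2) / 2) =
        N * M / n₁ + N * M / (2 * n₁) * (m₁ / n₁) := by
      field_simp
      ring
    rw [h3]
    push_cast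
    rw [add_div]
    linarith
  have hK : 1 ≤ N * M + m₁ := by nlinarith
  have hlogR : Real.log (((N * M + m₁ : ℕ) : ℝ) / n₁) ≤
      Real.log (N / n₁) + Real.log M + Real.log (m₁ / n₁ + 2) - Real.log 2 := by
    have hK0 : (0 : ℝ) < (N * M + m₁ : ℕ) := by exact_mod_cast hK
    refine (Real.log_le_log (by positivity) hR).trans_eq ?_
    rw [Real.log_mul (by positivity) (by positivity), Real.log_mul (by positivity) (by positivity),
      Real.log_div (x := (m₁ : ℝ) / n₁ + 2) (by positivity) (by norm_num)]
    ring
  have hpow : (1 - ε) ^ (N - n₁) ≤ Real.exp (-ε * (N - n₁)) := by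
    have hcast : ((N - n₁ : ℕ) : ℝ) = N - n₁ := Nat.cast_sub (by omega)
    calc (1 - ε) ^ (N - n₁) ≤ Real.exp (-ε) ^ (N - n₁) :=
          pow_le_pow_left₀ (by linarith) (Real.one_sub_le_exp_neg ε) _
      _ = _ := by rw [← Real.exp_nat_mul, hcast, mul_comm]
  calc ((N * M + m₁).choose n₁ : ℝ) * (1 - ε) ^ (N - n₁)
      ≤ Real.exp (n₁ * (1 + Real.log ((N * M + m₁ : ℕ) / n₁))) * Real.exp (-ε * (N - n₁)) :=
        mul_le_mul (choose_le_exp hK hn₁) hpow (pow_nonneg (by linarith) _) (Real.exp_pos _).le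
    _ = Real.exp (n₁ * (1 + Real.log ((N * M + m₁ : ℕ) / n₁)) + -ε * (N - n₁)) :=
        (Real.exp_add _ _).symm
    _ ≤ Real.exp (Real.log β) := by
        refine Real.exp_le_exp.2 ?_
        have h1 : n₁ * (1 + Real.log ((N * M + m₁ : ℕ) / n₁)) ≤
            n₁ * (1 + (ε * N / (2 * n₁) + Real.log (2 / ε) - 1 + (Real.log 2 + 1 + l) +
              Real.log (m₁ / n₁ + 2) - Real.log 2)) :=
          mul_le_mul_of_nonneg_left (by linarith) hn0.le
        have h2 : n₁ * (ε * N / (2 * n₁)) = ε * N / 2 := by field_simp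
        have h3 : Real.log (1 / β) = -Real.log β := by rw [one_div, Real.log_inv]
        linarith
    _ = β := Real.exp_log hβ

lemma mul_sampleBound (n₁ n₂ m₁ m₂ : ℕ) {ε : ℝ} (β : ℝ) (hε : ε ≠ 0) :
    ε * sampleBound n₁ n₂ m₁ m₂ ε β = 2 * Real.log (1 / β) +
      2 * n₁ * (2 * n₂ * (Real.log (m₂ / (n₂ + 1)) + 1)) +
      2 * n₁ * (Real.log (m₁ / n₁ + 2) + Real.log (2 / ε) + 1) + 2 * n₁ * ε := by
  unfold sampleBound
  field_simp
  ring

lemma log_terms_nonneg {n₂ m₂ : ℕ} (hm₂ : n₂ + 1 ≤ m₂) (n₁ m₁ : ℕ) {ε β : ℝ}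
    (hε : ε ∈ Set.Ioo (0 : ℝ) 1) (hβ : β ∈ Set.Ioo (0 : ℝ) 1) :
    0 ≤ Real.log (1 / β) ∧ 0 ≤ Real.log (m₂ / (n₂ + 1)) ∧ 0 ≤ Real.log (m₁ / n₁ + 2) ∧
      0 ≤ Real.log (2 / ε) := by
  have hm : (n₂ : ℝ) + 1 ≤ m₂ := by exact_mod_cast hm₂
  have ht : (0 : ℝ) ≤ m₁ / n₁ := by positivity
  refine ⟨Real.log_nonneg ?_, Real.log_nonneg ?_, Real.log_nonneg ?_, Real.log_nonneg ?_⟩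
  · rw [one_le_div hβ.1]
    exact hβ.2.le
  · rwa [one_le_div (by positivity)]
  · linarith
  · rw [one_le_div hε.1]
    linarith [hε.2]

lemma two_mul_le_sampleBound {n₁ n₂ m₂ : ℕ} (hm₂ : n₂ + 1 ≤ m₂) (m₁ : ℕ) {ε β : ℝ}
    (hε : ε ∈ Set.Ioo (0 : ℝ) 1) (hβ : β ∈ Set.Ioo (0 : ℝ) 1) :
    2 * (n₁ : ℝ) ≤ sampleBound n₁ n₂ m₁ m₂ ε β := by
  obtain ⟨h1, h2, h3, h4⟩ := log_terms_nonneg hm₂ n₁ m₁ hε hβ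
  have hε0 := hε.1
  unfold sampleBound
  have : 0 ≤ 2 / ε * Real.log (1 / β) + 4 * n₁ * n₂ / ε * (Real.log (m₂ / (n₂ + 1)) + 1)
      + 2 * n₁ / ε * (Real.log (m₁ / n₁ + 2) + Real.log (2 / ε) + 1) := by positivity
  linarith

lemma sampleBound_le {n₁ n₂ m₂ : ℕ} (hn₁ : 1 ≤ n₁) (hn₂ : 1 ≤ n₂) (hm₂ : n₂ + 1 ≤ m₂) (m₁ : ℕ)
    {ε β : ℝ} (hε : ε ∈ Set.Ioo (0 : ℝ) 1) (hβ : β ∈ Set.Ioo (0 : ℝ) 1) :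
    sampleBound n₁ n₂ m₁ m₂ ε β ≤ 8 * (n₁ * n₂ / ε) *
      (Real.log (1 / β) + Real.log (m₂ / (n₂ + 1)) + Real.log (m₁ / n₁ + 2)
        + Real.log (2 / ε) + 1) := by
  obtain ⟨h1, h2, h3, h4⟩ := log_terms_nonneg hm₂ n₁ m₁ hε hβ
  have hε0 := hε.1
  refine le_of_mul_le_mul_left ?_ hε0
  rw [mul_sampleBound _ _ _ _ _ hε0.ne']
  have hR : ∀ L : ℝ, ε * (8 * (n₁ * n₂ / ε) * L) = 8 * (n₁ * n₂) * L := fun L => by field_simp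
  rw [hR]
  have ha : (1 : ℝ) ≤ n₁ := by exact_mod_cast hn₁
  have hb : (1 : ℝ) ≤ n₂ := by exact_mod_cast hn₂
  have hab : (n₁ : ℝ) ≤ n₁ * n₂ := by nlinarith
  have hab1 : (1 : ℝ) ≤ n₁ * n₂ := by linarith
  have e1 := mul_le_mul_of_nonneg_right hab1 h1
  have e2 : 0 ≤ n₁ * n₂ * Real.log (m₂ / (n₂ + 1)) := by positivity
  have e3 := mul_le_mul_of_nonneg_right hab (by positivity :
    0 ≤ Real.log (m₁ / n₁ + 2) + Real.log (2 / ε) + 1)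
  have e4 : (n₁ : ℝ) * ε ≤ n₁ * n₂ := by nlinarith [hε.2]
  have e5 : 0 ≤ n₁ * n₂ * Real.log (m₁ / n₁ + 2) := by positivity
  have e6 : 0 ≤ n₁ * n₂ * Real.log (2 / ε) := by positivity
  have e7 : 0 ≤ n₁ * n₂ * Real.log (1 / β) := by positivity
  linarith

end

theorem mainTheorem2 {n₁ n₂ m₁ m₂ p r d : ℕ} (hn₁ : 1 ≤ n₁) (hn₂ : 1 ≤ n₂)
    (hpr : p + r = m₂) (hm₂ : n₂ + 1 ≤ m₂)
    (S : TwoStageSLP n₁ n₂ m₁ p r d) (hmeas : S.MeasurableData) (hdet : S.DetFeasible)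
    {Ω : Type*} [MeasurableSpace Ω] (P : Measure Ω) [IsProbabilityMeasure P]
    (ξ : Ω → Fin d → ℝ) (hξ : AEMeasurable ξ P)
    (ε β : ℝ) (hε : ε ∈ Set.Ioo (0 : ℝ) 1) (hβ : β ∈ Set.Ioo (0 : ℝ) 1) :
    (∀ N : ℕ, sampleBound n₁ n₂ m₁ m₂ ε β ≤ N →
      ∀ xstar : (Fin N → Fin d → ℝ) → Fin n₁ → ℝ,
        (∀ᵐ s ∂(Measure.pi fun _ : Fin N => P.map ξ), S.IsBasicOptimalSAA s (xstar s)) →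
        ENNReal.ofReal (1 - β) ≤ (Measure.pi fun _ : Fin N => P.map ξ)
            {s | 1 - ε ≤ S.recourseLikelihood P ξ (xstar s)} ∧
          (Measure.pi fun _ : Fin N => P.map ξ)
            {s | S.recourseLikelihood P ξ (xstar s) < 1 - ε} ≤ ENNReal.ofReal β) ∧
    sampleBound n₁ n₂ m₁ m₂ ε β ≤ 8 * (n₁ * n₂ / ε) *
      (Real.log (1 / β) + Real.log (m₂ / (n₂ + 1)) + Real.log (m₁ / n₁ + 2)
        + Real.log (2 / ε) + 1) := by
  refine ⟨fun N hN xstar hxstar => ?_, sampleBound_le hn₁ hn₂ hm₂ m₁ hε hβ⟩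
  have : IsProbabilityMeasure (P.map ξ) := Measure.isProbabilityMeasure_map hξ
  have hbad : (Measure.pi fun _ : Fin N => P.map ξ)
      {s | S.recourseLikelihood P ξ (xstar s) < 1 - ε} ≤ ENNReal.ofReal β := by
    refine (TwoStageSLP.measure_recourseLikelihood_lt_le hmeas P hξ hε hxstar).trans
      (ENNReal.ofReal_le_ofReal ?_)
    rw [card_eqSelection]
    refine choose_mul_pow_le hn₁ (one_le_card_cutLabel n₂ p r) hε hβ.1 ?_
      (log_card_cutLabel_le hn₂ hpr hm₂) ?_
    · exact_mod_cast (two_mul_le_sampleBound hm₂ m₁ hε hβ).trans hN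
    · rw [← mul_sampleBound n₁ n₂ m₁ m₂ β hε.1.ne']
      exact mul_le_mul_of_nonneg_left hN hε.1.le
  refine ⟨?_, hbad⟩
  -- Subadditivity suffices to pass to the complement, so `xstar` need not be measurable.
  have hcover : (Set.univ : Set (Fin N → Fin d → ℝ)) ⊆
      {s | 1 - ε ≤ S.recourseLikelihood P ξ (xstar s)} ∪
        {s | S.recourseLikelihood P ξ (xstar s) < 1 - ε} :=
    fun s _ => le_or_gt (1 - ε) (S.recourseLikelihood P ξ (xstar s))
  have hone := (measure_mono (μ := Measure.pi fun _ : Fin N => P.map ξ) hcover).trans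
    (measure_union_le _ _)
  rw [measure_univ] at hone
  rw [ENNReal.ofReal_sub _ hβ.1.le, ENNReal.ofReal_one]
  exact tsub_le_iff_right.2 (hone.trans (by gcongr))
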